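/- Fix a base $b>1$; all logarithms and entropies below are taken to base $b$. Let $p,k$ be integers with $1\le k\le p$, let $\beta_{\min}>0$ and $0<\gamma\le 1$. Write $\phi(0,v)$ for the Gaussian density with mean $0$ and variance $v$, and define the mixture densities $$\overline\psi_1=\sum_{\ell=0}^{k}\binom{k}{\ell}\gamma^{\ell}(1-\gamma)^{k-\ell}\,\phi\Big(0,1+\frac{\ell\beta_{\min}^2}{\gamma}\Big),\qquad \overline\psi_2=\gamma\,\phi\Big(0,1+\frac{\beta_{\min}^2}{\gamma}\Big)+(1-\gamma)\,\phi(0,1).$$ Let $H(f)=-\int_{\mathbb R} f\log f$ denote differential entropy, let $H_{binary}(q)=-q\log q-(1-q)\log(1-q)$, and set $$g_1=\frac{\log\binom pk-1}{H(\overline\psi_1)-\frac12\log(2\pi e)},\qquad g_2=\frac{\log(p-k+1)-1}{H(\overline\psi_2)-\frac12\log(2\pi e)}.$$ The following bounds hold; those on $g_1$ whenever its numerator is nonnegative, i.e. $\log\binom pk\ge 1$, and those on $g_2$ whenever its numerator is nonnegative, i.e. $\log(p-k+1)\ge 1$. (a) In general, $$g_1\ge\frac{\log\binom pk-1}{\frac12\log(1+k\beta_{\min}^2)},\qquad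 g_2\ge\frac{\log(p-k+1)-1}{\frac12\log(1+\beta_{\min}^2)}.$$ (b) If $\gamma k=\tau$, then $$g_1\ge\frac{\log\binom pk-1}{\frac12\tau\log\big(1+\frac{k\beta_{\min}^2}{\tau}\big)+C},\qquad g_2\ge\frac{\log(p-k+1)-1}{\frac12\frac{\tau}{k}\log\big(1+\frac{k\beta_{\min}^2}{\tau}\big)+H_{binary}\big(\frac{\tau}{k}\big)},$$ where $C=\frac12\log\big(2\pi e(\tau+\frac1{12})\big)$. (c) If $\gamma k\le 1$, then $$g_1\ge\frac{\log\binom pk-1}{\frac12\gamma k\log\big(1+\frac{\beta_{\min}^2}{\gamma}\big)+k\,H_{binary}(\gamma)},\qquad g_2\ge\frac{\log(p-k+1)-1}{\frac12\gamma\log\big(1+\frac{\beta_{\min}^2}{\gamma}\big)+H_{binary}(\gamma)}.$$ -/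

import Mathlib

namespace SparseRecovery

/-- The centred Gaussian density `φ(0, v)` with variance `v` (used for `v > 0` only). -/
noncomputable def phi (v : ℝ) (y : ℝ) : ℝ :=
  ProbabilityTheory.gaussianPDFReal 0 v.toNNReal y

/-- The Gaussian mixture density with binomial weights
`∑ ℓ ∈ {0,…,k}, C(k,ℓ) γ^ℓ (1-γ)^(k-ℓ) φ(0, 1 + ℓ β² / γ)`. -/
noncomputable def psi1 (k : ℕ) (β γ : ℝ) (y : ℝ) : ℝ :=
  ∑ l ∈ Finset.range (k + 1),
    (k.choose l : ℝ) * γ ^ l * (1 - γ) ^ (k - l) * phi (1 + l * β ^ 2 / γ) y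

/-- The two-component mixture density `γ φ(0, 1 + β²/γ) + (1 - γ) φ(0, 1)`. -/
noncomputable def psi2 (β γ : ℝ) (y : ℝ) : ℝ :=
  γ * phi (1 + β ^ 2 / γ) y + (1 - γ) * phi 1 y

/-- The differential entropy, to base `b`, of a probability density `f` on the real line. -/
noncomputable def diffEntropy (b : ℝ) (f : ℝ → ℝ) : ℝ :=
  -∫ y, f y * Real.logb b (f y)

/-- The entropy, to base `b`, of a `Ber(q)` variable
(`Real.binEntropy` is measured with natural logarithms). -/
noncomputable def hBinary (b q : ℝ) : ℝ :=
  Real.binEntropy q / Real.log b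

/-- The threshold `g₁(p, k, β_min, γ)`, all logarithms being taken to base `b`. -/
noncomputable def g1 (b : ℝ) (p k : ℕ) (βmin γ : ℝ) : ℝ :=
  (Real.logb b (p.choose k) - 1) /
    (diffEntropy b (psi1 k βmin γ) - 1 / 2 * Real.logb b (2 * Real.pi * Real.exp 1))

/-- The threshold `g₂(p, k, β_min, γ)`, all logarithms being taken to base `b`. -/
noncomputable def g2 (b : ℝ) (p k : ℕ) (βmin γ : ℝ) : ℝ :=
  (Real.logb b ((p : ℝ) - k + 1) - 1) /
    (diffEntropy b (psi2 βmin γ) - 1 / 2 * Real.logb b (2 * Real.pi * Real.exp 1))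

end SparseRecovery

open MeasureTheory ProbabilityTheory

namespace SparseRecovery

/-! ### Gaussian densities -/

/-! Since `psi2` is `psi1` with `k = 1`, every bound is an upper bound on the single quantity
`excessEntropy`, which is then inverted; inversion needs `excessEntropy_pos`, which holds because
conditioning on the component does not increase entropy. Bound (a) is the maximum-entropy property
of the Gaussian, the mixture having variance `1 + k * β ^ 2`. For (b) and (c), the entropy of the
mixture is at most that of its binomial index plus the mean entropy of its components
(`excessEntropy_le_entropy`). Bernoulli's inequality makes the second term linear in the index, so
only the mean `k * γ` enters. The index entropy is bounded by that of the `k` trials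
(`entropy_binomial_le`), or by that of a Gaussian of variance `γ * k + 1 / 12`
(`entropy_binomial_le_gaussian`). -/

lemma phi_pos {v : ℝ} (hv : 0 < v) (y : ℝ) : 0 < phi v y :=
  gaussianPDFReal_pos 0 _ y (Real.toNNReal_pos.2 hv).ne'

lemma phi_eq {v : ℝ} (hv : 0 < v) (y : ℝ) :
    phi v y = (√(2 * Real.pi * v))⁻¹ * Real.exp (-y ^ 2 / (2 * v)) := by
  simp [phi, gaussianPDFReal, Real.coe_toNNReal v hv.le]

lemma log_phi {v : ℝ} (hv : 0 < v) (y : ℝ) :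
    Real.log (phi v y) = -(1 / 2 * Real.log (2 * Real.pi * v)) - y ^ 2 / (2 * v) := by
  rw [phi_eq hv, Real.log_mul (by positivity) (Real.exp_ne_zero _), Real.log_inv, Real.log_exp,
    Real.log_sqrt (by positivity)]
  ring

lemma integrable_phi (v : ℝ) : Integrable (phi v) :=
  integrable_gaussianPDFReal 0 v.toNNReal

lemma integral_phi {v : ℝ} (hv : 0 < v) : ∫ y, phi v y = 1 :=
  integral_gaussianPDFReal_eq_one 0 (Real.toNNReal_pos.2 hv).ne'

lemma integrable_phi_mul_sq {v : ℝ} (hv : 0 < v) : Integrable fun y ↦ phi v y * y ^ 2 := by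
  have h := (integrable_rpow_mul_exp_neg_mul_sq (b := (2 * v)⁻¹) (by positivity)
    (s := 2) (by norm_num)).const_mul (√(2 * Real.pi * v))⁻¹
  refine h.congr (Filter.Eventually.of_forall fun y ↦ ?_)
  simp only [phi_eq hv, Real.rpow_ofNat]
  rw [show -(2 * v)⁻¹ * y ^ 2 = -y ^ 2 / (2 * v) by ring]
  ring

lemma integral_phi_mul_sq {v : ℝ} (hv : 0 < v) : ∫ y, phi v y * y ^ 2 = v := by
  have h := variance_id_gaussianReal (μ := 0) (v := v.toNNReal)
  rw [variance_of_integral_eq_zero aemeasurable_id (by simp),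
    integral_gaussianReal_eq_integral_smul (Real.toNNReal_pos.2 hv).ne',
    Real.coe_toNNReal v hv.le] at h
  simpa [phi] using h

lemma integrable_phi_mul_affine_sq {v : ℝ} (hv : 0 < v) (A B : ℝ) :
    Integrable fun y ↦ phi v y * (A + B * y ^ 2) := by
  refine (((integrable_phi v).const_mul A).add ((integrable_phi_mul_sq hv).const_mul B)).congr
    (Filter.Eventually.of_forall fun y ↦ ?_)
  simp only [Pi.add_apply]
  ring

lemma integral_phi_mul_affine_sq {v : ℝ} (hv : 0 < v) (A B : ℝ) :
    ∫ y, phi v y * (A + B * y ^ 2) = A + B * v := by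
  have h : (fun y ↦ phi v y * (A + B * y ^ 2)) =
      fun y ↦ A * phi v y + B * (phi v y * y ^ 2) := by
    ext y
    ring
  rw [h, integral_add ((integrable_phi v).const_mul A) ((integrable_phi_mul_sq hv).const_mul B),
    integral_const_mul, integral_const_mul, integral_phi hv, integral_phi_mul_sq hv, mul_one]

lemma integrable_phi_mul_log_phi {v u : ℝ} (hv : 0 < v) (hu : 0 < u) :
    Integrable fun y ↦ phi v y * Real.log (phi u y) := by
  refine (integrable_phi_mul_affine_sq hv (-(1 / 2 * Real.log (2 * Real.pi * u)))
    (-(1 / (2 * u)))).congr (Filter.Eventually.of_forall fun y ↦ ?_)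
  simp only [log_phi hu]
  ring

lemma integral_phi_mul_log_phi {v u : ℝ} (hv : 0 < v) (hu : 0 < u) :
    ∫ y, phi v y * Real.log (phi u y) =
      -(1 / 2 * Real.log (2 * Real.pi * u)) - v / (2 * u) := by
  have h := integral_phi_mul_affine_sq hv (-(1 / 2 * Real.log (2 * Real.pi * u))) (-(1 / (2 * u)))
  rw [show -(1 / 2 * Real.log (2 * Real.pi * u)) - v / (2 * u) =
    -(1 / 2 * Real.log (2 * Real.pi * u)) + -(1 / (2 * u)) * v by ring, ← h]
  refine integral_congr_ae (Filter.Eventually.of_forall fun y ↦ ?_)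
  simp only [log_phi hu]
  ring

lemma phi_le {v : ℝ} (hv : 0 < v) (y : ℝ) : phi v y ≤ (√(2 * Real.pi * v))⁻¹ := by
  rw [phi_eq hv]
  refine mul_le_of_le_one_right (by positivity) (Real.exp_le_one_iff.2 ?_)
  rw [neg_div]
  exact neg_nonpos.2 (by positivity)

/-- The pointwise form of Gibbs' inequality. -/
lemma mul_log_sub_mul_log_le {p q : ℝ} (hp : 0 ≤ p) (hq : 0 < q) :
    p * Real.log q - p * Real.log p ≤ q - p := by
  rcases hp.eq_or_lt with rfl | hp
  · simpa using hq.le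
  · have h := mul_le_mul_of_nonneg_left (Real.log_le_sub_one_of_pos (div_pos hq hp)) hp.le
    rw [Real.log_div hq.ne' hp.ne'] at h
    calc _ = p * (Real.log q - Real.log p) := by ring
      _ ≤ _ := h
      _ = _ := by field_simp

/-- Gibbs' inequality for finite distributions. -/
lemma neg_sum_mul_log_le {ι : Type*} (s : Finset ι) (w q : ι → ℝ) (hw : ∀ i ∈ s, 0 ≤ w i)
    (hq : ∀ i ∈ s, 0 < q i) (h : ∑ i ∈ s, q i ≤ ∑ i ∈ s, w i) :
    -∑ i ∈ s, w i * Real.log (w i) ≤ -∑ i ∈ s, w i * Real.log (q i) := by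
  have := Finset.sum_le_sum fun i hi ↦ mul_log_sub_mul_log_le (hw i hi) (hq i hi)
  rw [Finset.sum_sub_distrib, Finset.sum_sub_distrib] at this
  linarith

/-! ### Entropy of finite Gaussian mixtures -/

section Mixture

variable {ι : Type*} (s : Finset ι) (w v : ι → ℝ)

/-- The density of a finite mixture of centred Gaussians. -/
noncomputable def mixture (y : ℝ) : ℝ := ∑ i ∈ s, w i * phi (v i) y

variable {s w v}

lemma mul_phi_le_mixture (hw : ∀ i ∈ s, 0 ≤ w i) (hv : ∀ i ∈ s, 0 < v i) {i : ι} (hi : i ∈ s)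
    (y : ℝ) : w i * phi (v i) y ≤ mixture s w v y :=
  Finset.single_le_sum (f := fun i ↦ w i * phi (v i) y)
    (fun j hj ↦ mul_nonneg (hw j hj) (phi_pos (hv j hj) y).le) hi

lemma exists_pos_weight (h1 : ∑ i ∈ s, w i = 1) : ∃ i ∈ s, 0 < w i := by
  by_contra! h
  have := Finset.sum_nonpos h
  linarith

lemma mixture_pos (hw : ∀ i ∈ s, 0 ≤ w i) (hv : ∀ i ∈ s, 0 < v i) (h1 : ∑ i ∈ s, w i = 1)
    (y : ℝ) : 0 < mixture s w v y := by
  obtain ⟨i, hi, hwi⟩ := exists_pos_weight h1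
  exact (mul_pos hwi (phi_pos (hv i hi) y)).trans_le (mul_phi_le_mixture hw hv hi y)

lemma integrable_mixture : Integrable (mixture s w v) :=
  integrable_finsetSum s fun i _ ↦ (integrable_phi (v i)).const_mul (w i)

lemma integral_mixture (hv : ∀ i ∈ s, 0 < v i) (h1 : ∑ i ∈ s, w i = 1) :
    ∫ y, mixture s w v y = 1 := by
  unfold mixture
  rw [integral_finsetSum s fun i _ ↦ (integrable_phi (v i)).const_mul (w i), ← h1]
  refine Finset.sum_congr rfl fun i hi ↦ ?_
  rw [integral_const_mul, integral_phi (hv i hi), mul_one]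

/-- One component of positive weight bounds the mixture from below, and the peak heights bound it
from above. The resulting quadratic growth makes the entropy integrals converge. -/
lemma exists_abs_log_mixture_le (hw : ∀ i ∈ s, 0 ≤ w i) (hv : ∀ i ∈ s, 0 < v i)
    (h1 : ∑ i ∈ s, w i = 1) :
    ∃ A B : ℝ, ∀ y, |Real.log (mixture s w v y)| ≤ A + B * y ^ 2 := by
  obtain ⟨i, hi, hwi⟩ := exists_pos_weight h1
  set M := ∑ j ∈ s, w j * (√(2 * Real.pi * v j))⁻¹
  refine ⟨|M| + |Real.log (w i) - 1 / 2 * Real.log (2 * Real.pi * v i)|, 1 / (2 * v i),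
    fun y ↦ abs_le.2 ⟨?_, ?_⟩⟩
  · have h := Real.log_le_log (mul_pos hwi (phi_pos (hv i hi) y)) (mul_phi_le_mixture hw hv hi y)
    rw [Real.log_mul hwi.ne' (phi_pos (hv i hi) y).ne', log_phi (hv i hi)] at h
    have h2 := neg_abs_le (Real.log (w i) - 1 / 2 * Real.log (2 * Real.pi * v i))
    have h3 := abs_nonneg M
    have h4 : 1 / (2 * v i) * y ^ 2 = y ^ 2 / (2 * v i) := by ring
    linarith
  · have h : mixture s w v y ≤ M :=
      Finset.sum_le_sum fun j hj ↦ mul_le_mul_of_nonneg_left (phi_le (hv j hj) y) (hw j hj)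
    have h2 := Real.log_le_sub_one_of_pos (mixture_pos hw hv h1 y)
    have h3 := le_abs_self M
    have h4 := abs_nonneg (Real.log (w i) - 1 / 2 * Real.log (2 * Real.pi * v i))
    have h5 : 0 ≤ 1 / (2 * v i) * y ^ 2 := by have := hv i hi; positivity
    linarith

lemma integrable_phi_mul_log_mixture (hw : ∀ i ∈ s, 0 ≤ w i) (hv : ∀ i ∈ s, 0 < v i)
    (h1 : ∑ i ∈ s, w i = 1) {u : ℝ} (hu : 0 < u) :
    Integrable fun y ↦ phi u y * Real.log (mixture s w v y) := by
  obtain ⟨A, B, h⟩ := exists_abs_log_mixture_le hw hv h1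
  refine (integrable_phi_mul_affine_sq hu A B).mono' ?_ (Filter.Eventually.of_forall fun y ↦ ?_)
  · exact (integrable_phi u).aestronglyMeasurable.mul
      (integrable_mixture.aestronglyMeasurable.aemeasurable.log.aestronglyMeasurable)
  · rw [norm_mul, Real.norm_eq_abs, Real.norm_eq_abs, abs_of_pos (phi_pos hu y)]
    exact mul_le_mul_of_nonneg_left (h y) (phi_pos hu y).le

lemma integral_mixture_mul_log (hw : ∀ i ∈ s, 0 ≤ w i) (hv : ∀ i ∈ s, 0 < v i)
    (h1 : ∑ i ∈ s, w i = 1) :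
    ∫ y, mixture s w v y * Real.log (mixture s w v y) =
      ∑ i ∈ s, w i * ∫ y, phi (v i) y * Real.log (mixture s w v y) := by
  simp_rw [← integral_const_mul]
  rw [← integral_finsetSum s fun i hi ↦
    (integrable_phi_mul_log_mixture hw hv h1 (hv i hi)).const_mul (w i)]
  refine integral_congr_ae (Filter.Eventually.of_forall fun y ↦ ?_)
  simp only
  conv_lhs => rw [mixture, Finset.sum_mul]
  simp only [mul_assoc, mixture]

/-- Conditioning on the component does not increase differential entropy. -/
lemma sum_le_neg_integral_mixture_mul_log (hw : ∀ i ∈ s, 0 ≤ w i) (hv : ∀ i ∈ s, 0 < v i)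
    (h1 : ∑ i ∈ s, w i = 1) :
    ∑ i ∈ s, w i * (1 / 2 * Real.log (2 * Real.pi * v i) + 1 / 2) ≤
      -∫ y, mixture s w v y * Real.log (mixture s w v y) := by
  rw [integral_mixture_mul_log hw hv h1, ← Finset.sum_neg_distrib]
  refine Finset.sum_le_sum fun i hi ↦ ?_
  rw [← mul_neg]
  refine mul_le_mul_of_nonneg_left ?_ (hw i hi)
  have hI := integrable_phi_mul_log_mixture hw hv h1 (hv i hi)
  have hJ := integrable_phi_mul_log_phi (hv i hi) (hv i hi)
  -- Gibbs' inequality for each component against the whole mixture.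
  have h := integral_mono (hI.sub hJ) (integrable_mixture.sub (integrable_phi (v i)))
    fun y ↦ mul_log_sub_mul_log_le (phi_pos (hv i hi) y).le (mixture_pos hw hv h1 y)
  rw [integral_sub' hI hJ, integral_sub' integrable_mixture (integrable_phi (v i)),
    integral_mixture hv h1, integral_phi (hv i hi), integral_phi_mul_log_phi (hv i hi) (hv i hi)]
    at h
  have h2 : v i / (2 * v i) = 1 / 2 := by have := hv i hi; field_simp
  linarith

/-- The entropy of a mixture is at most the entropy of the index plus the conditional entropy. -/
lemma neg_integral_mixture_mul_log_le_entropy (hw : ∀ i ∈ s, 0 ≤ w i) (hv : ∀ i ∈ s, 0 < v i)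
    (h1 : ∑ i ∈ s, w i = 1) :
    -∫ y, mixture s w v y * Real.log (mixture s w v y) ≤
      -∑ i ∈ s, w i * Real.log (w i) +
        ∑ i ∈ s, w i * (1 / 2 * Real.log (2 * Real.pi * v i) + 1 / 2) := by
  rw [integral_mixture_mul_log hw hv h1, ← Finset.sum_neg_distrib, ← Finset.sum_neg_distrib,
    ← Finset.sum_add_distrib]
  refine Finset.sum_le_sum fun i hi ↦ ?_
  rcases (hw i hi).eq_or_lt with h0 | hwi
  · simp [← h0]
  have hJ := integrable_phi_mul_log_phi (hv i hi) (hv i hi)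
  -- The mixture dominates its own term `w i * phi (v i)`, so its logarithm is at least `log (w i) +
  -- log (phi (v i))`.
  have h := integral_mono (((integrable_phi (v i)).const_mul (Real.log (w i))).add hJ)
    (integrable_phi_mul_log_mixture hw hv h1 (hv i hi)) fun y ↦ by
      have hpos := phi_pos (hv i hi) y
      have h := mul_le_mul_of_nonneg_left (Real.log_le_log (mul_pos hwi hpos)
        (mul_phi_le_mixture hw hv hi y)) hpos.le
      rw [Real.log_mul hwi.ne' hpos.ne'] at h
      simp only [Pi.add_apply]
      linarith
  rw [integral_add' ((integrable_phi (v i)).const_mul (Real.log (w i))) hJ, integral_const_mul,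
    integral_phi (hv i hi), integral_phi_mul_log_phi (hv i hi) (hv i hi)] at h
  have h2 : v i / (2 * v i) = 1 / 2 := by have := hv i hi; field_simp
  have h3 := mul_le_mul_of_nonneg_left h hwi.le
  rw [h2] at h3
  linarith

/-- Among densities of given variance the Gaussian one has the largest entropy. -/
lemma neg_integral_mixture_mul_log_le_gaussian (hw : ∀ i ∈ s, 0 ≤ w i) (hv : ∀ i ∈ s, 0 < v i)
    (h1 : ∑ i ∈ s, w i = 1) {V : ℝ} (hV : 0 < V) (hsum : ∑ i ∈ s, w i * v i = V) :
    -∫ y, mixture s w v y * Real.log (mixture s w v y) ≤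
      1 / 2 * Real.log (2 * Real.pi * V) + 1 / 2 := by
  have hA : Integrable fun y ↦ mixture s w v y * Real.log (phi V y) := by
    refine (integrable_finsetSum s fun i hi ↦
      (integrable_phi_mul_log_phi (hv i hi) hV).const_mul (w i)).congr
      (Filter.Eventually.of_forall fun y ↦ ?_)
    simp [mixture, Finset.sum_mul, mul_assoc]
  -- `log (phi V)` is quadratic in `y`, so the cross entropy sees the mixture only through its
  -- variance `V`.
  have hAval : ∫ y, mixture s w v y * Real.log (phi V y) =
      -(1 / 2 * Real.log (2 * Real.pi * V)) - 1 / 2 := by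
    calc _ = ∫ y, ∑ i ∈ s, w i * (phi (v i) y * Real.log (phi V y)) := by
          simp [mixture, Finset.sum_mul, mul_assoc]
      _ = ∑ i ∈ s, w i * (-(1 / 2 * Real.log (2 * Real.pi * V)) - v i / (2 * V)) := by
          rw [integral_finsetSum s fun i hi ↦
            (integrable_phi_mul_log_phi (hv i hi) hV).const_mul (w i)]
          refine Finset.sum_congr rfl fun i hi ↦ ?_
          rw [integral_const_mul, integral_phi_mul_log_phi (hv i hi) hV]
      _ = (∑ i ∈ s, w i) * (-(1 / 2 * Real.log (2 * Real.pi * V))) -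
            (∑ i ∈ s, w i * v i) / (2 * V) := by
          simp_rw [mul_sub]
          rw [Finset.sum_sub_distrib, Finset.sum_mul, Finset.sum_div]
          simp_rw [mul_div_assoc]
      _ = _ := by
          rw [h1, hsum]
          field_simp
  have hB : Integrable fun y ↦ mixture s w v y * Real.log (mixture s w v y) := by
    refine (integrable_finsetSum s fun i hi ↦
      (integrable_phi_mul_log_mixture hw hv h1 (hv i hi)).const_mul (w i)).congr
      (Filter.Eventually.of_forall fun y ↦ ?_)
    simp only
    conv_rhs => rw [mixture, Finset.sum_mul]
    simp only [mul_assoc, mixture]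
  have h := integral_mono (hA.sub hB) ((integrable_phi V).sub integrable_mixture)
    fun y ↦ mul_log_sub_mul_log_le (mixture_pos hw hv h1 y).le (phi_pos hV y)
  rw [integral_sub' hA hB, integral_sub' (integrable_phi V) integrable_mixture,
    integral_mixture hv h1, integral_phi hV, hAval] at h
  linarith

end Mixture

/-! ### The binomial distribution -/

/-- The weights of the binomial distribution. -/
noncomputable def binomialWeight (k : ℕ) (γ : ℝ) (l : ℕ) : ℝ :=
  (k.choose l : ℝ) * γ ^ l * (1 - γ) ^ (k - l)

/-- Lets the Bernstein polynomial identities supply the total mass, mean and variance of the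
binomial weights. -/
lemma bernsteinPolynomial_eval (k l : ℕ) (γ : ℝ) :
    (bernsteinPolynomial ℝ k l).eval γ = binomialWeight k γ l := by
  simp [bernsteinPolynomial, binomialWeight]

lemma binomialWeight_nonneg {γ : ℝ} (h0 : 0 ≤ γ) (h1 : γ ≤ 1) (k l : ℕ) :
    0 ≤ binomialWeight k γ l := by
  have : 0 ≤ 1 - γ := by linarith
  unfold binomialWeight
  positivity

lemma sum_binomialWeight (k : ℕ) (γ : ℝ) :
    ∑ l ∈ Finset.range (k + 1), binomialWeight k γ l = 1 := by
  simpa [Polynomial.eval_finsetSum, bernsteinPolynomial_eval] using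
    congrArg (Polynomial.eval γ) (bernsteinPolynomial.sum ℝ k)

lemma sum_binomialWeight_mul (k : ℕ) (γ : ℝ) :
    ∑ l ∈ Finset.range (k + 1), binomialWeight k γ l * l = k * γ := by
  simpa [Polynomial.eval_finsetSum, bernsteinPolynomial_eval, mul_comm] using
    congrArg (Polynomial.eval γ) (bernsteinPolynomial.sum_smul ℝ k)

lemma sum_binomialWeight_mul_sub_sq (k : ℕ) (γ : ℝ) :
    ∑ l ∈ Finset.range (k + 1), binomialWeight k γ l * ((l : ℝ) - k * γ) ^ 2 =
      k * γ * (1 - γ) := by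
  have h := congrArg (Polynomial.eval γ) (bernsteinPolynomial.variance ℝ k)
  simp only [Polynomial.eval_finsetSum, Polynomial.eval_mul, bernsteinPolynomial_eval,
    Polynomial.eval_pow, Polynomial.eval_sub, nsmul_eq_mul, Polynomial.eval_natCast,
    Polynomial.eval_X, Polynomial.eval_one] at h
  rw [← h]
  exact Finset.sum_congr rfl fun l _ ↦ by ring

/-- The binomial coefficient is at least 1, so its logarithm can be dropped. At `γ = 1` either the
weight vanishes or `l = k`, so the junk value `log 0` never matters. -/
lemma binomialWeight_mul_log_ge {γ : ℝ} (h0 : 0 < γ) (h1 : γ ≤ 1) {k l : ℕ} (hl : l ≤ k) :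
    binomialWeight k γ l * (l * Real.log γ + (k - l) * Real.log (1 - γ)) ≤
      binomialWeight k γ l * Real.log (binomialWeight k γ l) := by
  rcases h1.eq_or_lt with rfl | h1
  · rcases hl.eq_or_lt with rfl | hl
    · simp [binomialWeight]
    · simp [binomialWeight, Nat.sub_ne_zero_of_lt hl]
  · have h2 : 0 < 1 - γ := by linarith
    have hc : (1 : ℝ) ≤ k.choose l := by exact_mod_cast Nat.choose_pos hl
    refine mul_le_mul_of_nonneg_left ?_ (binomialWeight_nonneg h0.le h1.le k l)
    rw [binomialWeight, Real.log_mul (by positivity) (by positivity),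
      Real.log_mul (by positivity) (by positivity), Real.log_pow, Real.log_pow, Nat.cast_sub hl]
    have := Real.log_nonneg hc
    linarith

/-- The binomial entropy is at most the entropy of the `k` Bernoulli trials. -/
lemma entropy_binomial_le {γ : ℝ} (h0 : 0 < γ) (h1 : γ ≤ 1) (k : ℕ) :
    -∑ l ∈ Finset.range (k + 1), binomialWeight k γ l * Real.log (binomialWeight k γ l) ≤
      k * Real.binEntropy γ := by
  have h := Finset.sum_le_sum fun l hl ↦
    binomialWeight_mul_log_ge h0 h1 (Nat.lt_succ_iff.1 (Finset.mem_range.1 hl) : l ≤ k)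
  have h2 : ∑ l ∈ Finset.range (k + 1),
      binomialWeight k γ l * (l * Real.log γ + (k - l) * Real.log (1 - γ)) =
      (∑ l ∈ Finset.range (k + 1), binomialWeight k γ l * l) *
          (Real.log γ - Real.log (1 - γ)) +
        (∑ l ∈ Finset.range (k + 1), binomialWeight k γ l) * (k * Real.log (1 - γ)) := by
    rw [Finset.sum_mul, Finset.sum_mul, ← Finset.sum_add_distrib]
    exact Finset.sum_congr rfl fun l _ ↦ by ring
  rw [h2, sum_binomialWeight, sum_binomialWeight_mul] at h
  rw [Real.binEntropy, Real.log_inv, Real.log_inv]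
  linarith

lemma integral_quadratic_unit_interval (x a b c : ℝ) :
    ∫ y in (x - 1 / 2)..(x + 1 / 2), (a + b * y + c * y ^ 2) =
      a + b * x + c * (x ^ 2 + 1 / 12) := by
  rw [intervalIntegral.integral_add (Continuous.intervalIntegrable (by fun_prop) _ _)
      (Continuous.intervalIntegrable (by fun_prop) _ _),
    intervalIntegral.integral_add (Continuous.intervalIntegrable (by fun_prop) _ _)
      (Continuous.intervalIntegrable (by fun_prop) _ _)]
  rw [intervalIntegral.integral_const_mul, intervalIntegral.integral_const_mul, integral_id,
    integral_pow, intervalIntegral.integral_const, smul_eq_mul]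
  ring

/-- The lower bound that Jensen's inequality gives for the mass of the unit interval around `x`
under the Gaussian with mean `m` and variance `u`. -/
noncomputable def gaussianCell (m u x : ℝ) : ℝ :=
  (√(2 * Real.pi * u))⁻¹ * Real.exp (-((x - m) ^ 2 + 1 / 12) / (2 * u))

lemma continuous_phi_sub {u : ℝ} (hu : 0 < u) (m : ℝ) : Continuous fun y ↦ phi u (y - m) := by
  simp_rw [phi_eq hu]
  fun_prop

/-- The tangent bound `1 + t ≤ exp t`, taken at the mean exponent over the interval, gives a
quadratic minorant of the density whose integral is exactly the cell value. The `1 / 12` is the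
variance of a uniform variable on a unit interval. -/
lemma gaussianCell_le_integral {u : ℝ} (hu : 0 < u) (m x : ℝ) :
    gaussianCell m u x ≤ ∫ y in (x - 1 / 2)..(x + 1 / 2), phi u (y - m) := by
  set q := gaussianCell m u x with hq
  -- Coefficients in `y` of `q * (1 + ((x - m) ^ 2 + 1 / 12 - (y - m) ^ 2) / (2 * u))`.
  set a := q * (1 + ((x - m) ^ 2 + 1 / 12 - m ^ 2) / (2 * u)) with ha
  set b := q * (2 * m / (2 * u)) with hb
  set c := -(q / (2 * u)) with hc
  have hval : q = ∫ y in (x - 1 / 2)..(x + 1 / 2), (a + b * y + c * y ^ 2) := by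
    rw [integral_quadratic_unit_interval, ha, hb, hc]
    field_simp
    ring
  rw [hval]
  refine intervalIntegral.integral_mono_on (by linarith)
    (Continuous.intervalIntegrable (by fun_prop) _ _)
    ((continuous_phi_sub hu m).intervalIntegrable _ _) fun y _ ↦ ?_
  have h := Real.add_one_le_exp (((x - m) ^ 2 + 1 / 12 - (y - m) ^ 2) / (2 * u))
  have hq0 : 0 ≤ q := by rw [hq, gaussianCell]; positivity
  have h2 := mul_le_mul_of_nonneg_left h hq0
  calc a + b * y + c * y ^ 2
      = q * (((x - m) ^ 2 + 1 / 12 - (y - m) ^ 2) / (2 * u) + 1) := by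
        rw [ha, hb, hc]
        ring
    _ ≤ _ := h2
    _ = phi u (y - m) := by
        rw [hq, gaussianCell, phi_eq hu, mul_assoc, ← Real.exp_add]
        ring_nf

/-- The unit intervals around consecutive integers are adjacent, so their masses add up to at most
the total mass. The cells can thus serve as the reference weights in Gibbs' inequality. -/
lemma sum_gaussianCell_le_one {u : ℝ} (hu : 0 < u) (m : ℝ) (n : ℕ) :
    ∑ l ∈ Finset.range n, gaussianCell m u l ≤ 1 := by
  have hint : Integrable fun y ↦ phi u (y - m) := (integrable_phi u).comp_sub_right m
  have h := intervalIntegral.sum_integral_adjacent_intervals (n := n) (μ := volume)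
    (a := fun l : ℕ ↦ (l : ℝ) - 1 / 2) fun l _ ↦
      (continuous_phi_sub hu m).intervalIntegrable ((l : ℝ) - 1 / 2) (((l + 1 : ℕ) : ℝ) - 1 / 2)
  calc ∑ l ∈ Finset.range n, gaussianCell m u l
      ≤ ∑ l ∈ Finset.range n,
          ∫ y in ((l : ℝ) - 1 / 2)..(((l + 1 : ℕ) : ℝ) - 1 / 2), phi u (y - m) := by
        refine Finset.sum_le_sum fun l _ ↦ ?_
        rw [show ((l + 1 : ℕ) : ℝ) - 1 / 2 = (l : ℝ) + 1 / 2 by push_cast; ring]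
        exact gaussianCell_le_integral hu m l
    _ = _ := h
    _ ≤ ∫ y, phi u (y - m) := by
        rw [intervalIntegral.integral_of_le (by simp)]
        exact setIntegral_le_integral hint
          (Filter.Eventually.of_forall fun y ↦ (phi_pos hu _).le)
    _ = 1 := by rw [integral_sub_right_eq_self (phi u) m, integral_phi hu]

/-- The Gaussian bound on the binomial entropy. -/
lemma entropy_binomial_le_gaussian {γ : ℝ} (h0 : 0 < γ) (h1 : γ ≤ 1) (k : ℕ) :
    -∑ l ∈ Finset.range (k + 1), binomialWeight k γ l * Real.log (binomialWeight k γ l) ≤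
      1 / 2 * Real.log (2 * Real.pi * (γ * k + 1 / 12)) + 1 / 2 := by
  set u := γ * k + 1 / 12 with hu_def
  have hu : 0 < u := by positivity
  have hpos (l : ℕ) : 0 < gaussianCell (k * γ) u l := by unfold gaussianCell; positivity
  refine (neg_sum_mul_log_le _ _ (fun l : ℕ ↦ gaussianCell (k * γ) u l)
    (fun l _ ↦ binomialWeight_nonneg h0.le h1 k l) (fun l _ ↦ hpos l)
    ((sum_gaussianCell_le_one hu _ _).trans_eq (sum_binomialWeight k γ).symm)).trans ?_
  have hlog (l : ℕ) : Real.log (gaussianCell (k * γ) u l) =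
      -(1 / 2 * Real.log (2 * Real.pi * u)) - (((l : ℝ) - k * γ) ^ 2 + 1 / 12) / (2 * u) := by
    rw [gaussianCell, Real.log_mul (by positivity) (Real.exp_ne_zero _), Real.log_inv,
      Real.log_exp, Real.log_sqrt (by positivity)]
    ring
  have hsum : ∑ l ∈ Finset.range (k + 1),
      binomialWeight k γ l * Real.log (gaussianCell (k * γ) u l) =
      (∑ l ∈ Finset.range (k + 1), binomialWeight k γ l) *
          (-(1 / 2 * Real.log (2 * Real.pi * u)) - 1 / 12 / (2 * u)) -
        (∑ l ∈ Finset.range (k + 1), binomialWeight k γ l * ((l : ℝ) - k * γ) ^ 2) / (2 * u) := by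
    rw [Finset.sum_mul, Finset.sum_div, ← Finset.sum_sub_distrib]
    exact Finset.sum_congr rfl fun l _ ↦ by rw [hlog]; ring
  rw [hsum, sum_binomialWeight, sum_binomialWeight_mul_sub_sq]
  -- The binomial variance `k * γ * (1 - γ)` is at most `γ * k`, so with the extra `1 / 12` it is at
  -- most `u`.
  have h : 1 / 12 / (2 * u) + k * γ * (1 - γ) / (2 * u) ≤ 1 / 2 := by
    rw [← add_div, div_le_iff₀ (by positivity)]
    have : 0 ≤ k * γ * γ := by positivity
    rw [hu_def]
    linarith
  linarith

/-! ### Entropy of the binomial Gaussian mixture -/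

lemma psi1_eq_mixture (k : ℕ) (β γ : ℝ) :
    psi1 k β γ = mixture (Finset.range (k + 1)) (binomialWeight k γ)
      (fun l ↦ 1 + l * β ^ 2 / γ) := rfl

lemma psi2_eq_psi1 (β γ : ℝ) : psi2 β γ = psi1 1 β γ := by
  ext y
  simp [psi1, psi2, Finset.sum_range_succ, add_comm]

/-- The natural-logarithm entropy of `psi1` in excess of that of a standard Gaussian. -/
noncomputable def excessEntropy (k : ℕ) (β γ : ℝ) : ℝ :=
  -(∫ y, psi1 k β γ y * Real.log (psi1 k β γ y)) - 1 / 2 * (Real.log (2 * Real.pi) + 1)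

lemma diffEntropy_sub_eq (b : ℝ) (k : ℕ) (β γ : ℝ) :
    diffEntropy b (psi1 k β γ) - 1 / 2 * Real.logb b (2 * Real.pi * Real.exp 1) =
      excessEntropy k β γ / Real.log b := by
  have h : ∫ y, psi1 k β γ y * Real.logb b (psi1 k β γ y) =
      (∫ y, psi1 k β γ y * Real.log (psi1 k β γ y)) / Real.log b := by
    rw [← integral_div]
    simp only [Real.logb, mul_div_assoc]
  rw [diffEntropy, h, excessEntropy, Real.logb,
    Real.log_mul (by positivity) (Real.exp_ne_zero _), Real.log_exp]
  ring

section Bounds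

variable {k : ℕ} {β γ : ℝ}

lemma sum_component_entropy (h0 : 0 < γ) :
    ∑ l ∈ Finset.range (k + 1), binomialWeight k γ l *
        (1 / 2 * Real.log (2 * Real.pi * (1 + l * β ^ 2 / γ)) + 1 / 2) =
      1 / 2 * (Real.log (2 * Real.pi) + 1) +
        1 / 2 * ∑ l ∈ Finset.range (k + 1),
          binomialWeight k γ l * Real.log (1 + l * β ^ 2 / γ) := by
  have h : ∑ l ∈ Finset.range (k + 1), binomialWeight k γ l *
        (1 / 2 * Real.log (2 * Real.pi * (1 + l * β ^ 2 / γ)) + 1 / 2) =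
      (∑ l ∈ Finset.range (k + 1), binomialWeight k γ l) *
          (1 / 2 * (Real.log (2 * Real.pi) + 1)) +
        1 / 2 * ∑ l ∈ Finset.range (k + 1),
          binomialWeight k γ l * Real.log (1 + l * β ^ 2 / γ) := by
    rw [Finset.sum_mul, Finset.mul_sum, ← Finset.sum_add_distrib]
    refine Finset.sum_congr rfl fun l _ ↦ ?_
    rw [Real.log_mul (by positivity) (by positivity)]
    ring
  rw [h, sum_binomialWeight, one_mul]

lemma excessEntropy_pos (hk : 1 ≤ k) (hβ : 0 < β) (h0 : 0 < γ) (h1 : γ ≤ 1) :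
    0 < excessEntropy k β γ := by
  have h := sum_le_neg_integral_mixture_mul_log (s := Finset.range (k + 1))
    (w := binomialWeight k γ) (v := fun l ↦ 1 + l * β ^ 2 / γ)
    (fun l _ ↦ binomialWeight_nonneg h0.le h1 k l) (fun l _ ↦ by positivity)
    (sum_binomialWeight k γ)
  rw [sum_component_entropy h0, ← psi1_eq_mixture] at h
  have hnonneg : ∀ l ∈ Finset.range (k + 1),
      0 ≤ binomialWeight k γ l * Real.log (1 + l * β ^ 2 / γ) := fun l _ ↦
    mul_nonneg (binomialWeight_nonneg h0.le h1 k l)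
      (Real.log_nonneg (le_add_of_nonneg_right (by positivity)))
  -- The top index has weight `γ ^ k > 0` and variance above 1, so it alone makes the excess
  -- strictly positive.
  have hlast : 0 < binomialWeight k γ k * Real.log (1 + k * β ^ 2 / γ) := by
    have hk0 : (0 : ℝ) < k := by exact_mod_cast hk
    refine mul_pos ?_ (Real.log_pos (lt_add_of_pos_right 1 (by positivity)))
    simp only [binomialWeight, Nat.choose_self, Nat.sub_self, pow_zero]
    positivity
  have := hlast.trans_le (Finset.single_le_sum hnonneg (Finset.self_mem_range_succ k))
  unfold excessEntropy
  linarith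

lemma excessEntropy_le_gaussian (h0 : 0 < γ) (h1 : γ ≤ 1) :
    excessEntropy k β γ ≤ 1 / 2 * Real.log (1 + k * β ^ 2) := by
  have hsum : ∑ l ∈ Finset.range (k + 1), binomialWeight k γ l * (1 + l * β ^ 2 / γ) =
      1 + k * β ^ 2 := by
    calc _ = ∑ l ∈ Finset.range (k + 1), binomialWeight k γ l +
          (∑ l ∈ Finset.range (k + 1), binomialWeight k γ l * l) * (β ^ 2 / γ) := by
          rw [Finset.sum_mul, ← Finset.sum_add_distrib]
          exact Finset.sum_congr rfl fun l _ ↦ by ring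
      _ = _ := by
          rw [sum_binomialWeight, sum_binomialWeight_mul]
          field_simp
  have h := neg_integral_mixture_mul_log_le_gaussian (s := Finset.range (k + 1))
    (w := binomialWeight k γ) (v := fun l ↦ 1 + l * β ^ 2 / γ)
    (fun l _ ↦ binomialWeight_nonneg h0.le h1 k l) (fun l _ ↦ by positivity)
    (sum_binomialWeight k γ) (by positivity) hsum
  rw [← psi1_eq_mixture, Real.log_mul (by positivity) (by positivity)] at h
  unfold excessEntropy
  linarith

lemma log_one_add_nat_mul_le {x : ℝ} (hx : 0 ≤ x) (l : ℕ) :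
    Real.log (1 + l * x) ≤ l * Real.log (1 + x) := by
  rw [← Real.log_pow]
  exact Real.log_le_log (by positivity) (one_add_mul_le_pow (by linarith) l)

lemma excessEntropy_le_entropy (h0 : 0 < γ) (h1 : γ ≤ 1) :
    excessEntropy k β γ ≤ 1 / 2 * (γ * k) * Real.log (1 + β ^ 2 / γ) +
      -∑ l ∈ Finset.range (k + 1), binomialWeight k γ l * Real.log (binomialWeight k γ l) := by
  have h := neg_integral_mixture_mul_log_le_entropy (s := Finset.range (k + 1))
    (w := binomialWeight k γ) (v := fun l ↦ 1 + l * β ^ 2 / γ)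
    (fun l _ ↦ binomialWeight_nonneg h0.le h1 k l) (fun l _ ↦ by positivity)
    (sum_binomialWeight k γ)
  rw [sum_component_entropy h0, ← psi1_eq_mixture] at h
  have h2 : ∑ l ∈ Finset.range (k + 1), binomialWeight k γ l * Real.log (1 + l * β ^ 2 / γ) ≤
      k * γ * Real.log (1 + β ^ 2 / γ) := by
    rw [← sum_binomialWeight_mul, Finset.sum_mul]
    refine Finset.sum_le_sum fun l _ ↦ ?_
    rw [mul_assoc, mul_div_assoc]
    exact mul_le_mul_of_nonneg_left (log_one_add_nat_mul_le (by positivity) l)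
      (binomialWeight_nonneg h0.le h1 k l)
  unfold excessEntropy
  linarith

lemma excessEntropy_le_binEntropy (h0 : 0 < γ) (h1 : γ ≤ 1) :
    excessEntropy k β γ ≤
      1 / 2 * (γ * k) * Real.log (1 + β ^ 2 / γ) + k * Real.binEntropy γ :=
  (excessEntropy_le_entropy h0 h1).trans (by gcongr; exact entropy_binomial_le h0 h1 k)

lemma excessEntropy_le_log_variance (h0 : 0 < γ) (h1 : γ ≤ 1) :
    excessEntropy k β γ ≤ 1 / 2 * (γ * k) * Real.log (1 + β ^ 2 / γ) +
      1 / 2 * Real.log (2 * Real.pi * Real.exp 1 * (γ * k + 1 / 12)) := by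
  refine (excessEntropy_le_entropy h0 h1).trans ?_
  gcongr
  refine (entropy_binomial_le_gaussian h0 h1 k).trans_eq ?_
  rw [mul_right_comm (2 * Real.pi), Real.log_mul (y := Real.exp 1) (by positivity) (Real.exp_ne_zero _),
    Real.log_exp]
  ring

/-- An upper bound on the excess entropy gives a lower bound on the threshold. -/
lemma div_diffEntropy_ge {b N U U' : ℝ} (hb : 1 < b) (hk : 1 ≤ k) (hβ : 0 < β) (h0 : 0 < γ)
    (h1 : γ ≤ 1) (hN : 1 ≤ N) (hU : excessEntropy k β γ ≤ U) (hU' : U' = U / Real.log b) :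
    (N - 1) / (diffEntropy b (psi1 k β γ) -
      1 / 2 * Real.logb b (2 * Real.pi * Real.exp 1)) ≥ (N - 1) / U' := by
  have hlog := Real.log_pos hb
  rw [diffEntropy_sub_eq, hU']
  -- The numerator must be nonnegative and the smaller denominator positive for the quotients to
  -- compare.
  exact div_le_div_of_nonneg_left (by linarith) (div_pos (excessEntropy_pos hk hβ h0 h1) hlog)
    (div_le_div_of_nonneg_right hU hlog.le)

end Bounds

end SparseRecovery

theorem corollary2 (b : ℝ) (hb : 1 < b) (p k : ℕ) (hk : 1 ≤ k) (hkp : k ≤ p)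
    (βmin γ : ℝ) (hβ : 0 < βmin) (hγ0 : 0 < γ) (hγ1 : γ ≤ 1) :
    -- (a)
    ((1 ≤ Real.logb b (p.choose k) →
        SparseRecovery.g1 b p k βmin γ ≥
          (Real.logb b (p.choose k) - 1) / (1 / 2 * Real.logb b (1 + k * βmin ^ 2))) ∧
      (1 ≤ Real.logb b ((p : ℝ) - k + 1) →
        SparseRecovery.g2 b p k βmin γ ≥
          (Real.logb b ((p : ℝ) - k + 1) - 1) / (1 / 2 * Real.logb b (1 + βmin ^ 2)))) ∧
    -- (b)
    (∀ τ : ℝ, γ * k = τ →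
      (1 ≤ Real.logb b (p.choose k) →
        SparseRecovery.g1 b p k βmin γ ≥
          (Real.logb b (p.choose k) - 1) /
            (1 / 2 * τ * Real.logb b (1 + k * βmin ^ 2 / τ) +
              1 / 2 * Real.logb b (2 * Real.pi * Real.exp 1 * (τ + 1 / 12)))) ∧
      (1 ≤ Real.logb b ((p : ℝ) - k + 1) →
        SparseRecovery.g2 b p k βmin γ ≥
          (Real.logb b ((p : ℝ) - k + 1) - 1) /
            (1 / 2 * (τ / k) * Real.logb b (1 + k * βmin ^ 2 / τ) +
              SparseRecovery.hBinary b (τ / k)))) ∧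
    -- (c)
    (γ * k ≤ 1 →
      (1 ≤ Real.logb b (p.choose k) →
        SparseRecovery.g1 b p k βmin γ ≥
          (Real.logb b (p.choose k) - 1) /
            (1 / 2 * γ * k * Real.logb b (1 + βmin ^ 2 / γ) +
              k * SparseRecovery.hBinary b γ)) ∧
      (1 ≤ Real.logb b ((p : ℝ) - k + 1) →
        SparseRecovery.g2 b p k βmin γ ≥
          (Real.logb b ((p : ℝ) - k + 1) - 1) /
            (1 / 2 * γ * Real.logb b (1 + βmin ^ 2 / γ) +
              SparseRecovery.hBinary b γ))) := by
  have hk0 : (0 : ℝ) < k := by exact_mod_cast hk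
  simp only [SparseRecovery.g1, SparseRecovery.g2, SparseRecovery.psi2_eq_psi1]
  refine ⟨⟨fun hN ↦ ?_, fun hN ↦ ?_⟩, ?_, fun _ ↦ ⟨fun hN ↦ ?_, fun hN ↦ ?_⟩⟩
  · exact SparseRecovery.div_diffEntropy_ge hb hk hβ hγ0 hγ1 hN (SparseRecovery.excessEntropy_le_gaussian hγ0 hγ1)
      (by rw [Real.logb]; ring)
  · refine SparseRecovery.div_diffEntropy_ge hb le_rfl hβ hγ0 hγ1 hN (SparseRecovery.excessEntropy_le_gaussian hγ0 hγ1) ?_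
    rw [Real.logb, Nat.cast_one, one_mul]
    ring
  · rintro τ rfl
    -- Eliminating `τ` turns the second bound of (b) into the second bound of (c), whose proof does
    -- not need `γ * k ≤ 1`.
    have hτ : k * βmin ^ 2 / (γ * k) = βmin ^ 2 / γ := by field_simp
    have hτk : γ * k / k = γ := by field_simp
    rw [hτ, hτk]
    refine ⟨fun hN ↦ ?_, fun hN ↦ ?_⟩
    · refine SparseRecovery.div_diffEntropy_ge hb hk hβ hγ0 hγ1 hN (SparseRecovery.excessEntropy_le_log_variance hγ0 hγ1) ?_
      rw [Real.logb, Real.logb]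
      ring
    · refine SparseRecovery.div_diffEntropy_ge hb le_rfl hβ hγ0 hγ1 hN (SparseRecovery.excessEntropy_le_binEntropy hγ0 hγ1) ?_
      rw [Real.logb, SparseRecovery.hBinary, Nat.cast_one]
      ring
  · refine SparseRecovery.div_diffEntropy_ge hb hk hβ hγ0 hγ1 hN (SparseRecovery.excessEntropy_le_binEntropy hγ0 hγ1) ?_
    rw [Real.logb, SparseRecovery.hBinary]
    ring
  · refine SparseRecovery.div_diffEntropy_ge hb le_rfl hβ hγ0 hγ1 hN (SparseRecovery.excessEntropy_le_binEntropy hγ0 hγ1) ?_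
    rw [Real.logb, SparseRecovery.hBinary, Nat.cast_one]
    ring
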